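/- **Theorem.** Let $G$ be a finite group, $p$ a prime and $m \ge 1$ an integer. For a complex character $\chi$ of $G$ (the character of a finite-dimensional complex representation of $G$), let $\mathbb{Q}(\chi)$ be the field generated over $\mathbb{Q}$ by the values of $\chi$; call $\chi$ *unramified at $p$* if the extension $\mathbb{Q}(\chi)/\mathbb{Q}$ is unramified at $p$. For $g, g' \in G$ write $\chi(g) \equiv \chi(g') \bmod p^m$ if $\chi(g) - \chi(g') \in p^m \mathcal{O}_{\mathbb{Q}(\chi)}$, where $\mathcal{O}_{\mathbb{Q}(\chi)}$ is the ring of integers of $\mathbb{Q}(\chi)$. 1. If $g, h \in G$, $h$ commutes with $g$, and the order of $h$ is a power of $p$, then $$\chi(g) \equiv \chi\bigl(g h^{p^{m-1}}\bigr) \bmod p^m$$ for every character $\chi$ of $G$ that is unramified at $p$. 2. Let $\sim_m$ be the equivalence relation on $G$ generated by conjugation and by $g \sim_m g h^{p^{m-1}}$ whenever $h$ commutes with $g$ and has order a power of $p$. If $g \sim_m g'$, then $\chi(g) \equiv \chi(g') \bmod p^m$ for every character $\chi$ of $G$ that is unramified at $p$. -/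

import Mathlib

/-- The field `ℚ(χ)` generated over `ℚ` by the values of a complex-valued function `χ` on `G`. -/
noncomputable def characterField {G : Type*} (χ : G → ℂ) : IntermediateField ℚ ℂ :=
  IntermediateField.adjoin ℚ (Set.range χ)

/-- `χ` is unramified at `p`: the extension `ℚ(χ)/ℚ` is unramified at `p`, that is, every prime
of the ring of integers of `ℚ(χ)` lying over `p` is unramified over `ℤ`. -/
def IsUnramifiedCharacterAt {G : Type*} (χ : G → ℂ) (p : ℕ) : Prop :=
  Algebra.IsUnramifiedIn (NumberField.RingOfIntegers (characterField χ))
    (Ideal.span {(p : ℤ)})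

/-- `χ g ≡ χ g'` modulo `p ^ m`: the difference of the two values is `p ^ m` times an element of
the ring of integers of `ℚ(χ)`. -/
def CharacterCongr {G : Type*} (χ : G → ℂ) (p m : ℕ) (g g' : G) : Prop :=
  ∃ z : NumberField.RingOfIntegers (characterField χ),
    χ g - χ g' = (p : ℂ) ^ m * ((z : characterField χ) : ℂ)

/-- `h` has order a power of `p` (possibly `p ^ 0 = 1`). -/
def HasPrimePowerOrder {G : Type*} [Group G] (p : ℕ) (h : G) : Prop :=
  ∃ k : ℕ, orderOf h = p ^ k

/-- For `m ≥ 1`, the equivalence relation `g ∼_m g'` on `G` generated by conjugation and by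
`g ∼_m g * h ^ (p ^ (m - 1))` whenever `h` commutes with `g` and has order a power of `p`. -/
def PrimePowerRel {G : Type*} [Group G] (p m : ℕ) : G → G → Prop :=
  Relation.EqvGen fun a b : G =>
    IsConj a b ∨ ∃ h : G, Commute h a ∧ HasPrimePowerOrder p h ∧ b = a * h ^ p ^ (m - 1)

/-! Write g = xu, with x of order prime to p, u a p-element and both powers of g, and let the
abelian p-group A = ⟨u⟩ × ⟨h⟩ act on V. Then χ(xz) = ∑ c_ψ ψ(z) over the linear characters ψ of A,
where c_ψ, the trace of x on the ψ-isotypic part, is an algebraic integer. Unramifiedness makes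
inertia at p in the cyclotomic field of level |G| fix ℚ(χ). Hence χ(xz^t) = χ(xz) for t prime to p
(`Representation.character_pow_of_isUnramifiedCharacterAt`), and c_ψ depends only on the cyclic
group ⟨ψ⟩. By inclusion–exclusion it remains to sum ψ(a) - ψ(ab^(p^(m-1))) over a subgroup C of the
dual of A (`sum_subgroup_sub_mem_span`). If p^m divides |C|, each half is 0 or |C|; otherwise |C|
divides p^(m-1) and every term vanishes. -/

/-! ### Inertia acts trivially on fields unramified at p -/

/-- Two ring homomorphisms into a Noetherian domain that agree modulo a prime `𝔓` are equal, provided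
the source is unramified over `R` at the preimage of `𝔓`. -/
theorem Algebra.IsUnramifiedAt.algHom_ext {R S B : Type*} [CommRing R] [CommRing S] [CommRing B]
    [Algebra R S] [Algebra R B] [IsDomain B] [IsNoetherianRing B] (f₁ f₂ : S →ₐ[R] B)
    (P : Ideal B) [P.IsPrime] (q : Ideal S) [q.IsPrime] (hq : q = P.comap f₁)
    [Algebra.IsUnramifiedAt R q] (h : ∀ x, f₁ x - f₂ x ∈ P) : f₁ = f₂ := by
  have hq₂ : q = P.comap f₂ := by
    rw [hq]
    ext x
    rw [Ideal.mem_comap, Ideal.mem_comap]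
    exact ⟨fun hx => by simpa using P.sub_mem hx (h x), fun hx => by simpa using P.add_mem hx (h x)⟩
  let g₁ := Localization.localAlgHom q P f₁ hq
  let g₂ := Localization.localAlgHom q P f₂ hq₂
  have hg₁ (x : S) : g₁ (algebraMap S _ x) = algebraMap B _ (f₁ x) :=
    Localization.localRingHom_to_map q P f₁.toRingHom hq x
  have hg₂ (x : S) : g₂ (algebraMap S _ x) = algebraMap B _ (f₂ x) :=
    Localization.localRingHom_to_map q P f₂.toRingHom hq₂ x
  have hg : g₁ = g₂ := by
    have : IsNoetherianRing (Localization.AtPrime P) :=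
      IsLocalization.isNoetherianRing P.primeCompl _ inferInstance
    -- Agreement modulo the maximal ideal propagates to all its powers, whose intersection is zero
    -- by Krull.
    refine Algebra.FormallyUnramified.ext_of_iInf (R := R)
      (I := IsLocalRing.maximalIdeal (Localization.AtPrime P))
      (Ideal.iInf_pow_eq_bot_of_isLocalRing _ (Ideal.IsPrime.ne_top inferInstance)) fun x => ?_
    have key : (Ideal.Quotient.mk (IsLocalRing.maximalIdeal (Localization.AtPrime P))).comp
        (g₁ : Localization.AtPrime q →+* _) = (Ideal.Quotient.mk _).comp
        (g₂ : Localization.AtPrime q →+* _) := by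
      refine IsLocalization.ringHom_ext q.primeCompl (RingHom.ext fun y => ?_)
      simp only [RingHom.comp_apply, RingHom.coe_coe, hg₁, hg₂]
      rw [Ideal.Quotient.eq, ← map_sub, ← Ideal.mem_comap, ← Ideal.under_def,
        IsLocalization.AtPrime.under_maximalIdeal (Localization.AtPrime P) P]
      exact h y
    exact DFunLike.congr_fun key x
  ext x
  apply IsLocalization.injective (Localization.AtPrime P) P.primeCompl_le_nonZeroDivisors
  rw [← hg₁, ← hg₂, hg]

/-- A power map `b ↦ b ^ r` with `r ≡ 1` modulo `n` moves `n * p ^ a`-torsion elements only within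
their residue class modulo any prime containing `p`. -/
theorem Ideal.pow_sub_self_mem_of_modEq {B : Type*} [CommRing B] {p : ℕ} (hp : p.Prime)
    (P : Ideal B) [P.IsPrime] (hpP : (p : B) ∈ P) {n a r : ℕ} (hr : r ≡ 1 [MOD n]) {b : B}
    (hb : b ^ (p ^ a * n) = 1) : b ^ r - b ∈ P := by
  have : Fact p.Prime := ⟨hp⟩
  have hc : CharP (B ⧸ P) p := (CharP.charP_iff_prime_eq_zero hp).2 <| by
    rw [← map_natCast (Ideal.Quotient.mk P), Ideal.Quotient.eq_zero_iff_mem]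
    exact hpP
  rw [← Ideal.Quotient.eq, map_pow]
  set c := Ideal.Quotient.mk P b with hcdef
  have hc1 : c ^ (p ^ a * n) = 1 := by rw [hcdef, ← map_pow, hb, map_one]
  have hcn : c ^ n = 1 := by
    -- Frobenius: in characteristic p this power is c^(n p^a) - 1, and the quotient is a domain.
    have h0 : (c ^ n - 1) ^ p ^ a = 0 := by
      rw [sub_pow_char_pow, ← pow_mul, mul_comm, hc1, one_pow, sub_self]
    exact sub_eq_zero.1 (eq_zero_of_pow_eq_zero h0)
  have := pow_eq_pow_of_modEq hr hcn
  rwa [pow_one] at this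

open NumberField in
/-- If `K ⊆ ℚ(ζ)`, with `ζ` a root of unity of order `p ^ a * n`, is unramified at `p`, then `K` is
fixed by the automorphism `ζ ↦ ζ ^ r` of `ℚ(ζ)` for every `r ≡ 1` modulo `n`. -/
theorem exists_algEquiv_fixing_of_isUnramifiedIn {p : ℕ} (hp : p.Prime) {n a r : ℕ} (hn : n ≠ 0)
    (hr : r ≡ 1 [MOD n]) (hrn : r.Coprime (p ^ a * n)) {ζ : ℂ}
    (hζ : IsPrimitiveRoot ζ (p ^ a * n)) (K : IntermediateField ℚ ℂ)
    (hK : K ≤ IntermediateField.adjoin ℚ {ζ})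
    (hunr : Algebra.IsUnramifiedIn (𝓞 K) (Ideal.span {(p : ℤ)})) :
    ∃ σ : IntermediateField.adjoin ℚ {ζ} ≃ₐ[ℚ] IntermediateField.adjoin ℚ {ζ},
      (∀ w : IntermediateField.adjoin ℚ {ζ}, w ^ (p ^ a * n) = 1 → σ w = w ^ r) ∧
      ∀ x : IntermediateField.adjoin ℚ {ζ}, (x : ℂ) ∈ K → σ x = x := by
  have hN : NeZero (p ^ a * n) := ⟨mul_ne_zero (pow_ne_zero _ hp.ne_zero) hn⟩
  set L := IntermediateField.adjoin ℚ {ζ} with hL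
  have hcyc : IsCyclotomicExtension {p ^ a * n} ℚ L := by
    change IsCyclotomicExtension {p ^ a * n} ℚ L.toSubalgebra
    rw [hL, IntermediateField.adjoin_simple_toSubalgebra_of_isAlgebraic
      ((hζ.isIntegral hN.pos).tower_top (R := ℤ) (A := ℚ)).isAlgebraic]
    exact hζ.adjoin_isCyclotomicExtension ℚ
  have : NumberField L := IsCyclotomicExtension.numberField {p ^ a * n} ℚ L
  have hz := IsCyclotomicExtension.zeta_spec (p ^ a * n) ℚ L
  let σ : L ≃ₐ[ℚ] L := IsCyclotomicExtension.fromZetaAut (hz.pow_of_coprime r hrn)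
    (Polynomial.cyclotomic.irreducible_rat hN.pos)
  have hσ (w : L) (hw : w ^ (p ^ a * n) = 1) : σ w = w ^ r := by
    have h1 : σ (IsCyclotomicExtension.zeta (p ^ a * n) ℚ L)
        = IsCyclotomicExtension.zeta (p ^ a * n) ℚ L ^ r :=
      IsCyclotomicExtension.fromZetaAut_spec _ _
    obtain ⟨i, -, rfl⟩ := hz.eq_pow_of_pow_eq_one hw
    rw [map_pow, h1, pow_right_comm]
  refine ⟨σ, hσ, ?_⟩
  have : Fact p.Prime := ⟨hp⟩
  have hpmax : (Ideal.span {(p : ℤ)}).IsMaximal := Int.ideal_span_isMaximal_of_prime p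
  obtain ⟨P, hPmax, hPp⟩ := Ideal.exists_maximal_ideal_liesOver_of_isIntegral
    (Ideal.span {(p : ℤ)}) (S := 𝓞 L)
  have hpP : (p : 𝓞 L) ∈ P := by
    have : (p : ℤ) ∈ P.under ℤ := hPp.over ▸ Ideal.mem_span_singleton_self _
    simpa [Ideal.mem_comap] using this
  let τ : 𝓞 L →+* 𝓞 L := RingOfIntegers.mapRingHom (σ : L →+* L)
  have hcong (x : 𝓞 L) : τ x - x ∈ P := by
    -- Roots of unity generate 𝓞 L over ℤ, so the congruence need only be checked on them.
    have hx := IsCyclotomicExtension.adjoin_roots (S := {p ^ a * n}) (A := ℤ) x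
    induction hx using Algebra.adjoin_induction with
    | mem b hb =>
      obtain ⟨_, rfl, -, hb⟩ := hb
      have : τ b = b ^ r := RingOfIntegers.ext <| by
        refine (hσ b ?_).trans (map_pow (algebraMap (𝓞 L) L) b r).symm
        exact (map_pow (algebraMap (𝓞 L) L) b _).symm.trans (by rw [hb, map_one])
      rw [this]
      exact Ideal.pow_sub_self_mem_of_modEq hp P hpP hr hb
    | algebraMap k => simp
    | add x y _ _ hx hy => simpa [add_sub_add_comm] using P.add_mem hx hy
    | mul x y _ _ hx hy =>
      have : τ (x * y) - x * y = τ x * (τ y - y) + (τ x - x) * y := by rw [map_mul]; ring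
      rw [this]
      exact P.add_mem (P.mul_mem_left _ hy) (P.mul_mem_right _ hx)
  let f₁ : 𝓞 K →ₐ[ℤ] 𝓞 L :=
    (RingOfIntegers.mapRingHom (IntermediateField.inclusion hK : K →+* L)).toIntAlgHom
  let f₂ : 𝓞 K →ₐ[ℤ] 𝓞 L := (τ.comp f₁.toRingHom).toIntAlgHom
  have hlies : (P.comap f₁).LiesOver (Ideal.span {(p : ℤ)}) := ⟨by
    rw [hPp.over, Ideal.under_def, Ideal.under_def]
    ext k
    simp [Ideal.mem_comap]⟩
  have := hunr (P.comap f₁) inferInstance hlies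
  have hf : f₁ = f₂ := Algebra.IsUnramifiedAt.algHom_ext f₁ f₂ P _ rfl fun x => by
    rw [← neg_sub]
    exact P.neg_mem (hcong (f₁ x))
  have hfix : ∀ x : K, σ (IntermediateField.inclusion hK x) = IntermediateField.inclusion hK x := by
    intro x
    have : FiniteDimensional ℚ K := FiniteDimensional.of_injective
      (IntermediateField.inclusion hK).toLinearMap (IntermediateField.inclusion hK).injective
    have : NumberField K := ⟨⟩
    obtain ⟨y, z, hz, rfl⟩ := IsFractionRing.div_surjective (A := 𝓞 K) x
    have h (y : 𝓞 K) : σ (IntermediateField.inclusion hK y) = IntermediateField.inclusion hK y :=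
      congrArg (fun w : 𝓞 L => (w : L)) (DFunLike.congr_fun hf y).symm
    rw [map_div₀, map_div₀]
    exact congrArg₂ _ (h y) (h z)
  intro x hx
  exact hfix ⟨x, hx⟩

/-! ### Isotypic decomposition under a finite abelian group -/

section IsotypicProjection

variable {A V : Type*} [CommGroup A] [Fintype A] [AddCommGroup V] [Module ℂ V]

/-- The projection onto the `ψ`-isotypic part of a representation of a finite abelian group. -/
noncomputable def Representation.isotypicProjection (τ : Representation ℂ A V)
    (ψ : AddChar (Additive A) ℂ) : Module.End ℂ V :=
  (Fintype.card A : ℂ)⁻¹ • ∑ y : A, ψ (-Additive.ofMul y) • τ y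

variable (τ : Representation ℂ A V) (ψ : AddChar (Additive A) ℂ)

theorem Representation.apply_mul_isotypicProjection (z : A) :
    τ z * τ.isotypicProjection ψ = ψ (Additive.ofMul z) • τ.isotypicProjection ψ := by
  rw [isotypicProjection, mul_smul_comm, smul_comm (ψ (Additive.ofMul z)), Finset.mul_sum,
    Finset.smul_sum (r := ψ (Additive.ofMul z))]
  refine congrArg _ ?_
  refine Fintype.sum_equiv (Equiv.mulLeft z) _ _ fun y => ?_
  rw [mul_smul_comm, ← map_mul, Equiv.coe_mulLeft, smul_smul, ofMul_mul, neg_add,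
    AddChar.map_add_eq_mul, ← mul_assoc, ← AddChar.map_add_eq_mul, add_neg_cancel,
    AddChar.map_zero_eq_one, one_mul]

theorem Representation.isIdempotentElem_isotypicProjection :
    IsIdempotentElem (τ.isotypicProjection ψ) := by
  have h : τ.isotypicProjection ψ * τ.isotypicProjection ψ = (Fintype.card A : ℂ)⁻¹ •
      ∑ y : A, ψ (-Additive.ofMul y) • (τ y * τ.isotypicProjection ψ) := by
    conv_lhs => rw [isotypicProjection, smul_mul_assoc, Finset.sum_mul]
    simp_rw [smul_mul_assoc]
    rfl
  rw [IsIdempotentElem, h]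
  simp_rw [apply_mul_isotypicProjection, smul_smul, ← AddChar.map_add_eq_mul, neg_add_cancel,
    AddChar.map_zero_eq_one, one_smul]
  rw [Finset.sum_const, Finset.card_univ, ← Nat.cast_smul_eq_nsmul ℂ, smul_smul,
    inv_mul_cancel₀ (Nat.cast_ne_zero.2 Fintype.card_ne_zero), one_smul]

theorem Representation.sum_smul_isotypicProjection (z : A) :
    ∑ ψ : AddChar (Additive A) ℂ, ψ (Additive.ofMul z) • τ.isotypicProjection ψ = τ z := by
  classical
  have h (ψ : AddChar (Additive A) ℂ) : ψ (Additive.ofMul z) • τ.isotypicProjection ψ =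
      (Fintype.card A : ℂ)⁻¹ • ∑ y : A, ψ (Additive.ofMul z + -Additive.ofMul y) • τ y := by
    rw [isotypicProjection, smul_comm, Finset.smul_sum]
    simp_rw [smul_smul, ← AddChar.map_add_eq_mul]
  simp_rw [h]
  rw [← Finset.smul_sum, Finset.sum_comm]
  simp_rw [← Finset.sum_smul, AddChar.sum_apply_eq_ite, ← sub_eq_add_neg, sub_eq_zero,
    EmbeddingLike.apply_eq_iff_eq, ite_smul, zero_smul]
  rw [Finset.sum_ite_eq, if_pos (Finset.mem_univ _), Fintype.card_congr Additive.toMul, smul_smul,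
    inv_mul_cancel₀ (Nat.cast_ne_zero.2 Fintype.card_ne_zero), one_smul]

variable {τ} in
theorem Representation.commute_isotypicProjection {T : Module.End ℂ V} (hT : ∀ z, Commute T (τ z)) :
    Commute T (τ.isotypicProjection ψ) :=
  (Commute.sum_right _ _ _ fun z _ => (hT z).smul_right _).smul_right _

theorem Representation.trace_mul_apply_eq_sum (T : Module.End ℂ V) (z : A) :
    LinearMap.trace ℂ V (T * τ z) = ∑ ψ : AddChar (Additive A) ℂ,
      LinearMap.trace ℂ V (T * τ.isotypicProjection ψ) * ψ (Additive.ofMul z) := by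
  rw [← τ.sum_smul_isotypicProjection z, Finset.mul_sum, map_sum]
  exact Finset.sum_congr rfl fun ψ _ => by rw [mul_smul_comm, map_smul, smul_eq_mul, mul_comm]

theorem Representation.trace_mul_isotypicProjection (T : Module.End ℂ V) :
    LinearMap.trace ℂ V (T * τ.isotypicProjection ψ) = (Fintype.card A : ℂ)⁻¹ *
      ∑ y : A, ψ (-Additive.ofMul y) * LinearMap.trace ℂ V (T * τ y) := by
  simp [isotypicProjection, Finset.mul_sum]

theorem Representation.trace_mul_isotypicProjection_pow {T : Module.End ℂ V} {t : ℕ}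
    (ht : (Nat.card A).Coprime t)
    (h : ∀ z, LinearMap.trace ℂ V (T * τ (z ^ t)) = LinearMap.trace ℂ V (T * τ z)) :
    LinearMap.trace ℂ V (T * τ.isotypicProjection (ψ ^ t)) =
      LinearMap.trace ℂ V (T * τ.isotypicProjection ψ) := by
  rw [trace_mul_isotypicProjection, trace_mul_isotypicProjection]
  congr 1
  refine Fintype.sum_equiv (powCoprime ht) _ _ fun y => ?_
  rw [powCoprime_apply, h, ofMul_pow, ← smul_neg, AddChar.map_nsmul_eq_pow, AddChar.pow_apply]

/-- The trace of an endomorphism annihilated by `X ^ (n + 1) - X`, `n > 0`, is an algebraic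
integer. -/
theorem Module.End.isIntegral_trace_of_pow_succ_eq [FiniteDimensional ℂ V] {S : Module.End ℂ V}
    {n : ℕ} (hn : n ≠ 0) (hS : S ^ (n + 1) = S) : IsIntegral ℤ (LinearMap.trace ℂ V S) := by
  rw [trace_eq_sum_roots_charpoly_of_splits (IsAlgClosed.splits _)]
  refine IsIntegral.multiset_sum fun μ hμ => ?_
  have hμ' := (hasEigenvalue_iff_isRoot_charpoly S μ).2 (Polynomial.isRoot_of_mem_roots hμ)
  obtain ⟨v, hv⟩ := hμ'.exists_hasEigenvector
  have h := hv.pow_apply (n + 1)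
  rw [hS, hv.apply_eq_smul] at h
  have h' : μ = μ ^ (n + 1) := smul_left_injective ℂ hv.2 h
  refine ⟨Polynomial.X ^ (n + 1) - Polynomial.X, Polynomial.monic_X_pow_sub ?_, ?_⟩
  · rw [Polynomial.degree_X]
    exact_mod_cast Nat.lt_add_of_pos_left (Nat.pos_of_ne_zero hn)
  · simp [← h']

theorem Module.End.exists_nat_trace_eq_of_isIdempotentElem [FiniteDimensional ℂ V]
    {S : Module.End ℂ V} (hS : IsIdempotentElem S) : ∃ d : ℕ, LinearMap.trace ℂ V S = d :=
  ⟨_, (LinearMap.IsIdempotentElem.isProj_range S hS).trace⟩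

/-- The product is killed by X^(n+1) - X; X^n - 1 would not do, as the projection may have a kernel.
-/
theorem Representation.isIntegral_trace_mul_isotypicProjection [FiniteDimensional ℂ V]
    {T : Module.End ℂ V} {n : ℕ} (hn : n ≠ 0) (hTn : T ^ n = 1) (hT : ∀ z, Commute T (τ z)) :
    IsIntegral ℤ (LinearMap.trace ℂ V (T * τ.isotypicProjection ψ)) := by
  refine Module.End.isIntegral_trace_of_pow_succ_eq hn ?_
  rw [(commute_isotypicProjection ψ hT).mul_pow, pow_succ, hTn, one_mul,
    (τ.isIdempotentElem_isotypicProjection ψ).pow_succ_eq]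

end IsotypicProjection

/-! ### Character sums over a finite abelian p-group -/

section PGroup

variable {M : Type*} [CommGroup M] [Fintype M] {p : ℕ}

open Classical in
theorem sum_mem_subgroup_eq_ite (F : M →* ℂ) (C : Subgroup M) :
    ∑ x : M with x ∈ C, F x = if ∀ x ∈ C, F x = 1 then (Nat.card C : ℂ) else 0 := by
  have h : ∑ x : M with x ∈ C, F x = ∑ x : C, F.comp C.subtype x :=
    Finset.sum_subtype _ (by simp) F
  have hF : (∀ x ∈ C, F x = 1) ↔ F.comp C.subtype = 1 := by simp [MonoidHom.ext_iff]
  rw [h, sum_hom_units, Nat.card_eq_fintype_card]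
  simp_rw [hF, Nat.cast_ite, Nat.cast_zero]

open Classical in
theorem sum_subgroup_sub_mem_span (hp : p.Prime) (hM : IsPGroup p M) {m : ℕ}
    {F F' H : M →* ℂ} (hF : ∀ x, F' x = F x * H x ^ p ^ (m - 1)) (C : Subgroup M) :
    ∑ x : M with x ∈ C, (F x - F' x) ∈ Submodule.span (integralClosure ℤ ℂ) {(p : ℂ) ^ m} := by
  have : Fact p.Prime := ⟨hp⟩
  obtain ⟨k, hk⟩ := IsPGroup.iff_card.1 (hM.to_subgroup C)
  rcases le_or_gt m k with hmk | hkm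
  · have hcard : (Nat.card C : ℂ) ∈ Submodule.span (integralClosure ℤ ℂ) {(p : ℂ) ^ m} := by
      rw [Submodule.mem_span_singleton]
      refine ⟨(p : integralClosure ℤ ℂ) ^ (k - m), ?_⟩
      rw [hk, Algebra.smul_def, map_pow, map_natCast, ← pow_add, Nat.sub_add_cancel hmk,
        Nat.cast_pow]
    rw [Finset.sum_sub_distrib, sum_mem_subgroup_eq_ite, sum_mem_subgroup_eq_ite]
    refine sub_mem ?_ ?_ <;> split_ifs <;> first | exact hcard | exact zero_mem _
  · rw [Finset.sum_eq_zero fun x hx => ?_]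
    · exact zero_mem _
    · have hx : x ^ p ^ (m - 1) = 1 := by
        refine orderOf_dvd_iff_pow_eq_one.1 (dvd_trans ?_ (pow_dvd_pow p (Nat.le_sub_one_of_lt hkm)))
        rw [← hk]
        exact C.orderOf_dvd_natCard (Finset.mem_filter.1 hx).2
      rw [hF, ← map_pow, hx, map_one, mul_one, sub_self]

-- Each element of C generates exactly one D ≤ C, so the generators of C are C minus those of the
-- proper subgroups. For non-cyclic C the sum is empty.
open Classical in
theorem sum_generators_sub_mem_span (hp : p.Prime) (hM : IsPGroup p M) {m : ℕ}
    {F F' H : M →* ℂ} (hF : ∀ x, F' x = F x * H x ^ p ^ (m - 1)) (C : Subgroup M) :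
    ∑ x : M with Subgroup.zpowers x = C, (F x - F' x) ∈
      Submodule.span (integralClosure ℤ ℂ) {(p : ℂ) ^ m} := by
  induction C using WellFoundedLT.induction with
  | ind C ih =>
  have h := Finset.sum_fiberwise_of_maps_to (s := {x : M | x ∈ C}) (t := {D : Subgroup M | D ≤ C})
    (g := Subgroup.zpowers) (by simp) fun x => F x - F' x
  have hfib (D : Subgroup M) (hD : D ≤ C) : ∑ x ∈ {x : M | x ∈ C} with Subgroup.zpowers x = D,
      (F x - F' x) = ∑ x with Subgroup.zpowers x = D, (F x - F' x) := by
    refine Finset.sum_congr ?_ fun _ _ => rfl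
    ext x
    simp only [Finset.mem_filter, Finset.mem_univ, true_and, and_iff_right_iff_imp]
    rintro rfl
    exact hD (Subgroup.mem_zpowers x)
  rw [Finset.sum_congr rfl fun D hD => hfib D (Finset.mem_filter.1 hD).2,
    ← Finset.add_sum_erase _ _ (a := C) (by simp)] at h
  rw [eq_sub_of_add_eq h]
  refine sub_mem (sum_subgroup_sub_mem_span hp hM hF C) (sum_mem fun D hD => ih D ?_)
  simp only [Finset.mem_erase, Finset.mem_filter, Finset.mem_univ, true_and] at hD
  exact lt_of_le_of_ne hD.2 hD.1

/-- Let `c` be a family of algebraic integers indexed by a finite abelian `p`-group `M` which is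
constant on the generators of each cyclic subgroup. Then `∑ c x * F x` depends, modulo `p ^ m`, only
on the linear character `F` of `M` up to `p ^ (m - 1)`-th powers. -/
theorem sum_mul_sub_sum_mul_mem_span (hp : p.Prime) (hM : IsPGroup p M) {m : ℕ}
    {F F' H : M →* ℂ} (hF : ∀ x, F' x = F x * H x ^ p ^ (m - 1)) {c : M → ℂ}
    (hc : ∀ x, IsIntegral ℤ (c x))
    (hgen : ∀ x y, Subgroup.zpowers x = Subgroup.zpowers y → c x = c y) :
    ∑ x, c x * F x - ∑ x, c x * F' x ∈ Submodule.span (integralClosure ℤ ℂ) {(p : ℂ) ^ m} := by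
  classical
  rw [← Finset.sum_sub_distrib]
  simp_rw [← mul_sub]
  rw [← Finset.sum_fiberwise Finset.univ (Subgroup.zpowers (G := M))]
  refine sum_mem fun C _ => ?_
  rcases Finset.eq_empty_or_nonempty {x : M | Subgroup.zpowers x = C} with h | ⟨y, hy⟩
  · simp [h]
  · rw [Finset.sum_congr rfl fun x hx => by
      rw [hgen x y ((Finset.mem_filter.1 hx).2.trans (Finset.mem_filter.1 hy).2.symm)],
      ← Finset.mul_sum]
    exact Submodule.smul_mem _ (⟨c y, hc y⟩ : integralClosure ℤ ℂ)
      (sum_generators_sub_mem_span hp hM hF C)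

/-- Two generators of the same cyclic subgroup of a `p`-group are prime-to-`p` powers of each
other. -/
theorem IsPGroup.exists_pow_eq_of_zpowers_eq (hp : p.Prime) (hM : IsPGroup p M) {x y : M}
    (h : Subgroup.zpowers x = Subgroup.zpowers y) : ∃ t : ℕ, p.Coprime t ∧ y ^ t = x := by
  have : Fact p.Prime := ⟨hp⟩
  obtain ⟨t, ht⟩ : ∃ t : ℕ, y ^ t = x :=
    mem_powers_iff_mem_zpowers.2 (h ▸ Subgroup.mem_zpowers x)
  rcases eq_or_ne y 1 with rfl | hy
  · exact ⟨1, Nat.coprime_one_right p, by simpa using ht⟩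
  refine ⟨t, ?_, ht⟩
  have ho : orderOf (y ^ t) = orderOf y := by
    rw [ht, ← Nat.card_zpowers, h, Nat.card_zpowers]
  rw [orderOf_pow, Nat.div_eq_self] at ho
  have hpy : p ∣ orderOf y := by
    obtain ⟨k, hk⟩ := IsPGroup.iff_orderOf.1 hM y
    rw [hk]
    refine dvd_pow_self p ?_
    rintro rfl
    exact hy (orderOf_eq_one_iff.1 (by simpa using hk))
  exact Nat.Coprime.coprime_dvd_left hpy (ho.resolve_left (orderOf_pos y).ne')

end PGroup

theorem Representation.trace_mul_sub_mem_span {A V : Type*} [CommGroup A] [Finite A]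
    [AddCommGroup V] [Module ℂ V] [FiniteDimensional ℂ V] {p : ℕ} (hp : p.Prime)
    (hA : IsPGroup p A) {m : ℕ} (τ : Representation ℂ A V) {T : Module.End ℂ V} {n : ℕ}
    (hn : n ≠ 0) (hTn : T ^ n = 1) (hT : ∀ z, Commute T (τ z))
    (hinv : ∀ t, p.Coprime t → ∀ z,
      LinearMap.trace ℂ V (T * τ (z ^ t)) = LinearMap.trace ℂ V (T * τ z)) (a b : A) :
    LinearMap.trace ℂ V (T * τ a) - LinearMap.trace ℂ V (T * τ (a * b ^ p ^ (m - 1))) ∈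
      Submodule.span (integralClosure ℤ ℂ) {(p : ℂ) ^ m} := by
  have := Fintype.ofFinite A
  have : Fact p.Prime := ⟨hp⟩
  obtain ⟨k, hk⟩ := IsPGroup.iff_card.1 hA
  have hM : IsPGroup p (AddChar (Additive A) ℂ) := by
    refine IsPGroup.of_card (n := k) ?_
    rw [Nat.card_eq_fintype_card, AddChar.card_eq, Fintype.card_congr Additive.toMul,
      ← Nat.card_eq_fintype_card, hk]
  -- Duality: elements of A become linear characters of M, the dual of A.
  let ev (z : A) : AddChar (Additive A) ℂ →* ℂ :=
    { toFun ψ := ψ (Additive.ofMul z)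
      map_one' := rfl
      map_mul' _ _ := rfl }
  rw [trace_mul_apply_eq_sum, trace_mul_apply_eq_sum]
  refine sum_mul_sub_sum_mul_mem_span (F := ev a) (F' := ev (a * b ^ p ^ (m - 1))) (H := ev b)
    hp hM (fun ψ => ?_)
    (fun ψ => τ.isIntegral_trace_mul_isotypicProjection ψ hn hTn hT) fun ψ ψ' h => ?_
  · change ψ (Additive.ofMul (a * b ^ p ^ (m - 1))) = _ * ψ _ ^ p ^ (m - 1)
    rw [ofMul_mul, AddChar.map_add_eq_mul, ofMul_pow, AddChar.map_nsmul_eq_pow]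
    rfl
  · obtain ⟨t, ht, rfl⟩ := hM.exists_pow_eq_of_zpowers_eq hp h
    exact τ.trace_mul_isotypicProjection_pow ψ' (hk ▸ ht.pow_left k) (hinv t ht)

/-! ### Galois invariance of character values -/

section Character

variable {G : Type*} [Group G] [Finite G] {V : Type*} [AddCommGroup V] [Module ℂ V]
  [FiniteDimensional ℂ V] (ρ : Representation ℂ G V)

open scoped IsMulCommutative in
/-- The values of a character on the powers of `g` are power sums of roots of unity. -/
theorem Representation.exists_character_pow_eq_sum (g : G) :
    ∃ (ι : Type) (_ : Fintype ι) (d : ι → ℕ) (w : ι → ℂ), (∀ i, w i ^ Nat.card G = 1) ∧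
      ∀ r : ℕ, ρ.character (g ^ r) = ∑ i, d i * w i ^ r := by
  have := Fintype.ofFinite (Subgroup.zpowers g)
  let τ : Representation ℂ (Subgroup.zpowers g) V := ρ.comp (Subgroup.zpowers g).subtype
  let γ : Subgroup.zpowers g := ⟨g, Subgroup.mem_zpowers g⟩
  have hd (ψ : AddChar (Additive (Subgroup.zpowers g)) ℂ) :=
    Module.End.exists_nat_trace_eq_of_isIdempotentElem (τ.isIdempotentElem_isotypicProjection ψ)
  choose d hd using hd
  -- Reindexing by `Fin` puts the index type in `Type`, whatever the universe of G.
  let e := Fintype.equivFin (AddChar (Additive (Subgroup.zpowers g)) ℂ)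
  refine ⟨_, inferInstance, fun i => d (e.symm i), fun i => e.symm i (Additive.ofMul γ),
    fun i => ?_, fun r => ?_⟩
  · have hγ : γ ^ Nat.card G = 1 := Subtype.ext (by simp [γ])
    rw [← AddChar.map_nsmul_eq_pow, ← ofMul_pow, hγ, ofMul_one, AddChar.map_zero_eq_one]
  · have h := τ.trace_mul_apply_eq_sum 1 (γ ^ r)
    rw [one_mul] at h
    refine h.trans (Fintype.sum_equiv e _ _ fun ψ => ?_)
    simp only [one_mul, hd, ofMul_pow, AddChar.map_nsmul_eq_pow, e.symm_apply_apply]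

theorem Representation.characterField_le_adjoin {ζ : ℂ} (hζ : IsPrimitiveRoot ζ (Nat.card G)) :
    characterField ρ.character ≤ IntermediateField.adjoin ℚ {ζ} := by
  have : NeZero (Nat.card G) := ⟨Nat.card_pos.ne'⟩
  refine IntermediateField.adjoin_le_iff.2 ?_
  rintro _ ⟨g, rfl⟩
  obtain ⟨ι, _, d, w, hw, h⟩ := ρ.exists_character_pow_eq_sum g
  rw [← pow_one g, h]
  refine sum_mem fun i _ => mul_mem (natCast_mem _ _) (pow_mem ?_ _)
  obtain ⟨j, -, hj⟩ := hζ.eq_pow_of_pow_eq_one (hw i)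
  rw [← hj]
  exact pow_mem (IntermediateField.mem_adjoin_simple_self ℚ ζ) j

/-- A character unramified at `p` is invariant under `g ↦ g ^ r`, where `r` is prime to `|G|` and
congruent to `1` modulo the prime-to-`p` part of `|G|`. -/
theorem Representation.character_pow_of_isUnramifiedCharacterAt {p : ℕ} (hp : p.Prime)
    (hρ : IsUnramifiedCharacterAt ρ.character p) {n a r : ℕ} (hG : Nat.card G = p ^ a * n)
    (hr : r ≡ 1 [MOD n]) (hrG : r.Coprime (Nat.card G)) (g : G) :
    ρ.character (g ^ r) = ρ.character g := by
  have hG0 : Nat.card G ≠ 0 := Nat.card_pos.ne'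
  have : NeZero (Nat.card G) := ⟨hG0⟩
  have hζ := Complex.isPrimitiveRoot_exp (Nat.card G) hG0
  set ζ := Complex.exp (2 * Real.pi * Complex.I / (Nat.card G))
  obtain ⟨σ, hσ, hfix⟩ := exists_algEquiv_fixing_of_isUnramifiedIn hp
    (right_ne_zero_of_mul (hG ▸ hG0)) hr (hG ▸ hrG) (hG ▸ hζ) _ (ρ.characterField_le_adjoin hζ) hρ
  obtain ⟨ι, _, d, w, hw, h⟩ := ρ.exists_character_pow_eq_sum g
  have hwL (i) : w i ∈ IntermediateField.adjoin ℚ {ζ} := by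
    obtain ⟨j, -, hj⟩ := hζ.eq_pow_of_pow_eq_one (hw i)
    rw [← hj]
    exact pow_mem (IntermediateField.mem_adjoin_simple_self ℚ ζ) j
  let w' (i) : IntermediateField.adjoin ℚ {ζ} := ⟨w i, hwL i⟩
  have hval (s : ℕ) :
      ((∑ i, d i * w' i ^ s : IntermediateField.adjoin ℚ {ζ}) : ℂ) = ρ.character (g ^ s) := by
    simp [h, w']
  have h1 := hfix (∑ i, d i * w' i ^ 1) <| by
    rw [hval]
    exact IntermediateField.subset_adjoin _ _ (Set.mem_range_self _)
  have h2 : σ (∑ i, d i * w' i ^ 1) = ∑ i, d i * w' i ^ r := by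
    rw [map_sum]
    refine Finset.sum_congr rfl fun i _ => ?_
    rw [map_mul, map_natCast, pow_one, hσ _ (Subtype.ext (by simpa [w', hG] using hw i))]
  rw [← hval, ← h2, h1, hval, pow_one]

end Character

/-! ### Congruences in the ring of integers of ℚ(χ) -/

section Congruence

variable {G : Type*} {χ : G → ℂ} {p m : ℕ}

/-- Divisibility in the ring of all algebraic integers suffices: the quotient is integral and, being
a quotient of elements of ℚ(χ), lies in ℚ(χ). -/
theorem characterCongr_of_sub_mem_span (hp : p ≠ 0) {g g' : G}
    (h : χ g - χ g' ∈ Submodule.span (integralClosure ℤ ℂ) {(p : ℂ) ^ m}) :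
    CharacterCongr χ p m g g' := by
  obtain ⟨w, hw⟩ := Submodule.mem_span_singleton.1 h
  have hpm : (p : ℂ) ^ m ≠ 0 := pow_ne_zero _ (Nat.cast_ne_zero.2 hp)
  have hw' : (w : ℂ) = (χ g - χ g') / (p : ℂ) ^ m := by
    rw [← hw, eq_div_iff hpm]
    rfl
  have hmem : (w : ℂ) ∈ characterField χ := by
    rw [hw']
    have hχ (x : G) : χ x ∈ characterField χ :=
      IntermediateField.subset_adjoin _ _ (Set.mem_range_self x)
    exact div_mem (sub_mem (hχ g) (hχ g')) (pow_mem (natCast_mem _ _) _)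
  have hint : IsIntegral ℤ (⟨w, hmem⟩ : characterField χ) :=
    (isIntegral_algHom_iff ((characterField χ).val.restrictScalars ℤ)
      (characterField χ).val.injective).1 w.2
  refine ⟨⟨⟨w, hmem⟩, hint⟩, ?_⟩
  rw [← hw, mul_comm]
  rfl

theorem CharacterCongr.of_eq {g g' : G} (h : χ g = χ g') : CharacterCongr χ p m g g' :=
  ⟨0, by simp [h]⟩

theorem CharacterCongr.symm {g g' : G} (h : CharacterCongr χ p m g g') :
    CharacterCongr χ p m g' g := by
  obtain ⟨z, hz⟩ := h
  refine ⟨-z, ?_⟩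
  rw [← neg_sub, hz]
  simp

theorem CharacterCongr.trans {g₁ g₂ g₃ : G} (h : CharacterCongr χ p m g₁ g₂)
    (h' : CharacterCongr χ p m g₂ g₃) : CharacterCongr χ p m g₁ g₃ := by
  obtain ⟨z, hz⟩ := h
  obtain ⟨z', hz'⟩ := h'
  refine ⟨z + z', ?_⟩
  rw [← sub_add_sub_cancel _ (χ g₂), hz, hz', ← mul_add]
  simp

end Congruence

/-! ### The congruence for commuting p-elements -/

open scoped IsMulCommutative in
/-- A character unramified at `p` takes congruent values at `g` and `g * h ^ p ^ (m - 1)` when `h` is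
a `p`-element commuting with `g`. -/
theorem Representation.characterCongr_mul_pow {G : Type*} [Group G] [Finite G] {p : ℕ}
    (hp : p.Prime) {m : ℕ} {V : Type*} [AddCommGroup V] [Module ℂ V]
    [FiniteDimensional ℂ V] (ρ : Representation ℂ G V)
    (hρ : IsUnramifiedCharacterAt ρ.character p) {g h : G} (hgh : Commute h g)
    (hh : HasPrimePowerOrder p h) : CharacterCongr ρ.character p m g (g * h ^ p ^ (m - 1)) := by
  have : Fact p.Prime := ⟨hp⟩
  obtain ⟨a, n, hpn, hG⟩ := Nat.exists_eq_pow_mul_and_not_dvd (Nat.card_pos (α := G)).ne' p hp.ne_one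
  have hn : n ≠ 0 := by
    rintro rfl
    exact hpn (dvd_zero p)
  have hcop : (p ^ a).Coprime n := ((Nat.Prime.coprime_iff_not_dvd hp).2 hpn).pow_left a
  -- g^r₀ is the p-part u of g, and g^r₁ the part x of order prime to p.
  obtain ⟨r₀, hr₀p, hr₀n⟩ := Nat.chineseRemainder hcop 1 0
  obtain ⟨r₁, hr₁p, hr₁n⟩ := Nat.chineseRemainder hcop 0 1
  have hgr : g ^ r₁ * g ^ r₀ = g := by
    rw [← pow_add]
    conv_rhs => rw [← pow_one g]
    refine pow_eq_pow_of_modEq ?_ (pow_card_eq_one' (x := g))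
    rw [hG, ← Nat.modEq_and_modEq_iff_modEq_mul hcop]
    exact ⟨hr₁p.add hr₀p, hr₁n.add hr₀n⟩
  have hu : (g ^ r₀) ^ p ^ a = 1 := by
    rw [← pow_mul, ← orderOf_dvd_iff_pow_eq_one]
    refine (orderOf_dvd_natCard g).trans ?_
    rw [hG, mul_comm]
    exact Nat.mul_dvd_mul_right (Nat.modEq_zero_iff_dvd.1 hr₀n) _
  have hx : (g ^ r₁) ^ n = 1 := by
    rw [← pow_mul, ← orderOf_dvd_iff_pow_eq_one]
    refine (orderOf_dvd_natCard g).trans ?_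
    rw [hG]
    exact Nat.mul_dvd_mul_right (Nat.modEq_zero_iff_dvd.1 hr₁p) _
  have hcomm (y : Subgroup.zpowers (g ^ r₀)) (z : Subgroup.zpowers h) :
      Commute ((Subgroup.zpowers (g ^ r₀)).subtype y) ((Subgroup.zpowers h).subtype z) := by
    obtain ⟨_, i, rfl⟩ := y
    obtain ⟨_, j, rfl⟩ := z
    exact ((hgh.symm.pow_left r₀).zpow_left i).zpow_right j
  -- The external product is used since ⟨u⟩ and ⟨h⟩ may intersect; φ need not be injective.
  let φ : Subgroup.zpowers (g ^ r₀) × Subgroup.zpowers h →* G :=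
    MonoidHom.noncommCoprod _ _ hcomm
  have hφx (z) : Commute (g ^ r₁) (φ z) := by
    obtain ⟨⟨_, i, rfl⟩, ⟨_, j, rfl⟩⟩ := z
    exact ((Commute.pow_pow_self g r₁ r₀).zpow_right i).mul_right
      ((hgh.symm.pow_left r₁).zpow_right j)
  have hA : IsPGroup p (Subgroup.zpowers (g ^ r₀) × Subgroup.zpowers h) := by
    obtain ⟨i, -, hi⟩ := (Nat.dvd_prime_pow hp).1 (orderOf_dvd_of_pow_eq_one hu)
    obtain ⟨j, hj⟩ := hh
    refine IsPGroup.of_card (n := i + j) ?_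
    rw [Nat.card_prod, Nat.card_zpowers, Nat.card_zpowers, hi, hj, pow_add]
  have hφp (z) : φ z ^ p ^ a = 1 := by
    obtain ⟨k, hk⟩ := hA z
    have h1 : orderOf (φ z) ∣ p ^ k :=
      orderOf_dvd_of_pow_eq_one (by rw [← map_pow, hk, map_one])
    obtain ⟨l, -, hl⟩ := (Nat.dvd_prime_pow hp).1 h1
    have h2 : orderOf (φ z) ∣ p ^ a * n := hG ▸ orderOf_dvd_natCard _
    refine orderOf_dvd_iff_pow_eq_one.1 (Nat.Coprime.dvd_of_dvd_mul_right ?_ h2)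
    rw [hl]
    exact ((Nat.Prime.coprime_iff_not_dvd hp).2 hpn).pow_left l
  let τ : Representation ℂ (Subgroup.zpowers (g ^ r₀) × Subgroup.zpowers h) V := ρ.comp φ
  have htr (z) : LinearMap.trace ℂ V (ρ (g ^ r₁) * τ z) = ρ.character (g ^ r₁ * φ z) :=
    congrArg _ (map_mul ρ _ _).symm
  have hinv (t : ℕ) (ht : p.Coprime t) (z) : LinearMap.trace ℂ V (ρ (g ^ r₁) * τ (z ^ t)) =
      LinearMap.trace ℂ V (ρ (g ^ r₁) * τ z) := by
    -- The r-th power fixes x and acts as the t-th power on the image of φ.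
    obtain ⟨r, hrp, hrn⟩ := Nat.chineseRemainder hcop t 1
    have hrG : r.Coprime (Nat.card G) := by
      rw [hG]
      refine Nat.Coprime.mul_right ?_ ?_
      · exact (hrp.gcd_eq).trans (ht.pow_left a).symm
      · exact (hrn.gcd_eq).trans (Nat.coprime_one_left n)
    rw [htr, htr, ← ρ.character_pow_of_isUnramifiedCharacterAt hp hρ hG hrn hrG (g ^ r₁ * φ z),
      (hφx z).mul_pow, pow_eq_pow_of_modEq hrn hx, pow_eq_pow_of_modEq hrp (hφp z), pow_one, map_pow]
  refine characterCongr_of_sub_mem_span hp.ne_zero ?_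
  -- With a = (u, 1) and b = (1, h), x φ(a) = g and φ(b) = h.
  have key := τ.trace_mul_sub_mem_span (m := m) hp hA hn (by rw [← map_pow, hx, map_one])
    (fun z => (hφx z).map ρ) hinv (⟨_, Subgroup.mem_zpowers _⟩, 1) (1, ⟨h, Subgroup.mem_zpowers h⟩)
  rw [htr, htr, map_mul φ, map_pow φ] at key
  simpa [φ, ← mul_assoc, hgr] using key

theorem theorem3p3 {G : Type*} [Group G] [Finite G] (p : ℕ) (hp : p.Prime) (m : ℕ) (hm : 1 ≤ m)
    {V : Type*} [AddCommGroup V] [Module ℂ V] [FiniteDimensional ℂ V]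
    (ρ : Representation ℂ G V) (hρ : IsUnramifiedCharacterAt ρ.character p) :
    (∀ g h : G, Commute h g → HasPrimePowerOrder p h →
      CharacterCongr ρ.character p m g (g * h ^ p ^ (m - 1))) ∧
    (∀ g g' : G, PrimePowerRel p m g g' → CharacterCongr ρ.character p m g g') := by
  have key (g h : G) (hgh : Commute h g) (hh : HasPrimePowerOrder p h) :=
    ρ.characterCongr_mul_pow hp (m := m) hρ hgh hh
  refine ⟨key, fun g g' hr => ?_⟩
  induction hr with
  | rel x y hxy =>
    rcases hxy with hc | ⟨h, hgh, hh, rfl⟩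
    · obtain ⟨c, rfl⟩ := isConj_iff.1 hc
      exact .of_eq (ρ.char_conj x c).symm
    · exact key x h hgh hh
  | refl x => exact .of_eq rfl
  | symm x y _ ih => exact ih.symm
  | trans x y z _ _ ih ih' => exact ih.trans ih'
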